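/- Notation. For $0<\alpha<1$ let $E_\alpha(z)=\sum_{k\ge 0}\frac{z^k}{\Gamma(\alpha k+1)}$ be the Mittag-Leffler function. On $\mathbb R^n$ write $\hat f(\xi)=(2\pi)^{-n/2}\int e^{-ix\cdot\xi}f(x)\,dx$, let $\vee$ denote the inverse Fourier transform, and extend both to tempered distributions. For $\beta>0$, $t\ge 0$ and $\varphi\in L^1(\mathbb R^n)$ let \[T_t\varphi=\big[E_\alpha(-i\,t^\alpha|\xi|^\beta)\,\hat\varphi(\xi)\big]^\vee,\] the propagator of the time-fractional Schrödinger equation, understood as a tempered distribution. Fix $\phi\in C_c^\infty(\mathbb R^n)$ with $\phi(\xi)=1$ for $|\xi|\le 1$ and $\phi(\xi)=0$ for $|\xi|\ge 2$; for $j\in\mathbb Z$ put $\psi_j(\xi)=\phi(2^{-j}\xi)-\phi(2^{-(j-1)}\xi)$ and, for the dyadic number $N=2^j$, $P_Nu=[\psi_j\,\hat u]^\vee$. Theorem. Let $0<\alpha<1$ and $\beta>0$. For all $t\ge0$ and $\varphi\in L^1(\mathbb R^n)$ the function $E_\alpha(-it^\alpha|\xi|^\beta)\hat\varphi(\xi)$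 is essentially bounded, so that $T_t\varphi$ is well defined as a tempered distribution, and the following hold. (1) There is a constant $C>0$ depending only on $n,\alpha,\beta$ and $\phi$ such that for every $t\ge 0$, every dyadic number $N=2^j$, $j\in\mathbb Z$, and every $\varphi\in L^1(\mathbb R^n)$, the distribution $P_NT_t\varphi$ is an $L^\infty$ function and \[\|P_NT_t\varphi\|_{L^\infty(\mathbb R^n)}\le C\,\frac{N^n}{1+t^\alpha N^\beta}\,\|\varphi\|_{L^1(\mathbb R^n)}.\] (2) If $\beta>n$, there is a constant $C>0$ depending only on $n,\alpha,\beta$ such that for every $t>0$ and every $\varphi\in L^1(\mathbb R^n)$, the distribution $T_t\varphi$ is an $L^\infty$ function and \[\|T_t\varphi\|_{L^\infty(\mathbb R^n)}\le C\,t^{-\frac{n}{\beta}\alpha}\,\|\varphi\|_{L^1(\mathbb R^n)}.\] -/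

import Mathlib

open MeasureTheory SchwartzMap FourierTransform
open scoped ENNReal ContDiff

noncomputable section

/-- The Mittag-Leffler function `E_α(z) = ∑_{k ≥ 0} z ^ k / Γ(α k + 1)`. -/
def mittagLeffler (α : ℝ) (z : ℂ) : ℂ :=
  ∑' k : ℕ, z ^ k / (Real.Gamma (α * k + 1) : ℂ)

/-- The symbol `ξ ↦ E_α(-i t ^ α |ξ| ^ β)` of the propagator `T_t`, where `ξ` is the frequency
variable of the Fourier transform with kernel `exp (-i x · ξ)`. -/
def propagatorSymbol {n : ℕ} (α β t : ℝ) (ξ : EuclideanSpace ℝ (Fin n)) : ℂ :=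
  mittagLeffler α (-Complex.I * ((t ^ α * ‖ξ‖ ^ β : ℝ) : ℂ))

/-- The Fourier transform of `T_t φ`, i.e. the product of the symbol with the Fourier transform
of `φ`. Mathlib's Fourier transform `𝓕` has the kernel `exp (-2 π i x · ξ)`, so the frequency
called `ξ` for the kernel `exp (-i x · ξ)` is `2 π ξ` here; with this substitution the operator
`φ ↦ (m φ^)^∨` is the same for both normalisations of the Fourier transform. -/
def propagatorHat {n : ℕ} (α β t : ℝ) (φ : EuclideanSpace ℝ (Fin n) → ℂ)
    (ξ : EuclideanSpace ℝ (Fin n)) : ℂ :=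
  propagatorSymbol α β t ((2 * Real.pi) • ξ) * 𝓕 φ ξ

open Classical in
/-- The tempered distribution `η ↦ ∫ η f` of an essentially bounded function `f`
(and `0` if `f` is not essentially bounded). -/
def boundedToDistribution {n : ℕ} (f : EuclideanSpace ℝ (Fin n) → ℂ) :
    𝓢'(EuclideanSpace ℝ (Fin n), ℂ) :=
  if h : MemLp f ∞ (volume : Measure (EuclideanSpace ℝ (Fin n))) then
    Lp.toTemperedDistribution (h.toLp f)
  else 0

/-- The time-fractional Schrödinger propagator
`T_t φ = [E_α(-i t ^ α |ξ| ^ β) φ^(ξ)]^∨`, as a tempered distribution. -/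
def propagator {n : ℕ} (α β t : ℝ) (φ : EuclideanSpace ℝ (Fin n) → ℂ) :
    𝓢'(EuclideanSpace ℝ (Fin n), ℂ) :=
  𝓕⁻ (boundedToDistribution (propagatorHat α β t φ))

/-- A cutoff function `χ ∈ C_c^∞(ℝⁿ)` with `χ = 1` for `|ξ| ≤ 1` and `χ = 0` for `|ξ| ≥ 2`. -/
structure IsCutoff {n : ℕ} (χ : EuclideanSpace ℝ (Fin n) → ℂ) : Prop where
  contDiff : ContDiff ℝ ∞ χ
  eq_one : ∀ ξ, ‖ξ‖ ≤ 1 → χ ξ = 1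
  eq_zero : ∀ ξ, 2 ≤ ‖ξ‖ → χ ξ = 0

/-- `ψ_j(ξ) = χ(ξ / 2 ^ j) - χ(ξ / 2 ^ (j - 1))`. -/
def dyadicSymbol {n : ℕ} (χ : EuclideanSpace ℝ (Fin n) → ℂ) (j : ℤ)
    (ξ : EuclideanSpace ℝ (Fin n)) : ℂ :=
  χ (((2 : ℝ) ^ j)⁻¹ • ξ) - χ (((2 : ℝ) ^ (j - 1))⁻¹ • ξ)

/-- The frequency localisation `P_N u = [ψ_j(ξ) u^(ξ)]^∨`, `N = 2 ^ j`, of a tempered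
distribution `u`; the factor `2 π` is explained at `propagatorHat`. -/
def dyadicProjection {n : ℕ} (χ : EuclideanSpace ℝ (Fin n) → ℂ) (j : ℤ)
    (u : 𝓢'(EuclideanSpace ℝ (Fin n), ℂ)) : 𝓢'(EuclideanSpace ℝ (Fin n), ℂ) :=
  TemperedDistribution.fourierMultiplierCLM ℂ
    (fun ξ => dyadicSymbol χ j ((2 * Real.pi) • ξ)) u

end

/-!
The operators `T_t` and `P_N T_t` are Fourier multipliers. A multiplier `m ∈ L¹ ∩ L^∞` maps `L¹` to
`L^∞` with norm at most `‖m‖₁`, because `‖(m φ^)^∨‖_∞ ≤ ‖m φ^‖₁ ≤ ‖m‖₁ ‖φ‖₁`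
(`exists_multiplier_eq`). Both estimates therefore follow from the size of the symbol alone, once
`|E_α(-i s)| ≤ C / (1 + s)` for `s ≥ 0` is known (`exists_norm_mittagLeffler_le`): the symbol of
`P_N T_t` lives on `N / 2 ≤ |ξ| ≤ 2 N`, a set of measure `O(N ^ n)` on which it is
`O(1 / (1 + t ^ α N ^ β))`, and for `β > n` the function `1 / (1 + t ^ α |ξ| ^ β)` is integrable
with integral a multiple of `t ^ (-n α / β)` by scaling.

The decay of `E_α` comes from the representation
`E_α(z) = (2 π i)⁻¹ ∫ exp(s) s ^ (α - 1) / (s ^ α - z) ds` over a Hankel contour with rays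
`arg s = ±θ`, where `π / 2 < θ < min(π, π / (2 α))`. On these rays `exp s` decays, while `s ^ α`
stays in the sector `|arg| ≤ α θ < π / 2`, at distance at least `cos(α θ) (1 + σ) / 2` from
`z = -i σ` for `σ ≥ 0` when `|s| ≥ 1` (`norm_exp_add_I_mul_ge`). The representation is obtained on
a contour with a large arc by expanding in powers of `z / s ^ α` (`hasSum_mittagLeffler`), which
reduces it to Hankel's formula for `1 / Γ` (`hankelIntegral_hankelKernel`), and is then moved to the
contour with the unit arc by Cauchy's theorem (`hankelIntegral_shift`). Hankel's formula itself
follows from Euler's integral and the reflection formula by shrinking the arc when `0 < u < 1`, and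
extends to the remaining exponents by integration by parts.

All contour integrals are written in the coordinate `w = log s`. This makes `s ^ α = exp (α w)`
entire and turns the Hankel contour into the boundary of a half strip, so that Cauchy's theorem for
rectangles suffices.
-/

/-! ### Hankel contours and the reciprocal Gamma function -/

section HankelContour

open Set Filter Topology Complex

/-- The integral of `f` along the boundary of the half strip `re w > a`, `|im w| < θ`. Under
`s = exp w` this is a Hankel contour: two rays at the angles `±θ` joined by an arc of the circle
of radius `exp a`; the upper ray is traversed outwards. -/
noncomputable def hankelIntegral (θ a : ℝ) (f : ℂ → ℂ) : ℂ :=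
  (∫ x in Ioi a, (f (x + θ * I) - f (x - θ * I))) + I * ∫ y in (-θ)..θ, f (a + y * I)

theorem norm_exp_exp (x y : ℝ) :
    ‖cexp (cexp (x + y * I))‖ = Real.exp (Real.exp x * Real.cos y) := by
  simp [Complex.norm_exp, Complex.exp_re]

theorem norm_exp_exp_le {x y κ : ℝ} (h : Real.cos y ≤ -κ) :
    ‖cexp (cexp (x + y * I))‖ ≤ Real.exp (-κ * Real.exp x) := by
  rw [norm_exp_exp, mul_comm]
  gcongr

theorem eventually_exp_neg_mul_exp_le {κ : ℝ} (hκ : 0 < κ) (c : ℝ) :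
    ∀ᶠ x in atTop, Real.exp (-κ * Real.exp x) * Real.exp (c * x) ≤ Real.exp (-x) := by
  filter_upwards [eventually_ge_atTop (2 * |c + 1| / κ), eventually_ge_atTop 0] with x hx hx0
  rw [← Real.exp_add, Real.exp_le_exp]
  have h1 := Real.quadratic_le_exp_of_nonneg hx0
  have h2 : 2 * |c + 1| ≤ κ * x := by rwa [div_le_iff₀ hκ, mul_comm x] at hx
  have h3 : (c + 1) * x ≤ |c + 1| * x := by gcongr; exact le_abs_self _
  nlinarith [mul_le_mul_of_nonneg_left h1 hκ.le, mul_le_mul_of_nonneg_right h2 hx0]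

theorem integrableOn_exp_neg_mul_exp {κ : ℝ} (hκ : 0 < κ) (c a : ℝ) :
    IntegrableOn (fun x => Real.exp (-κ * Real.exp x) * Real.exp (c * x)) (Ioi a) := by
  refine integrable_of_isBigO_exp_neg (b := 1) one_pos (by fun_prop)
    (Asymptotics.IsBigO.of_bound 1 ?_)
  filter_upwards [eventually_exp_neg_mul_exp_le hκ c] with x hx
  rwa [one_mul, Real.norm_of_nonneg (by positivity), Real.norm_of_nonneg (by positivity),
    neg_one_mul]

theorem tendsto_exp_neg_mul_exp {κ : ℝ} (hκ : 0 < κ) (c : ℝ) :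
    Tendsto (fun x => Real.exp (-κ * Real.exp x) * Real.exp (c * x)) atTop (𝓝 0) :=
  squeeze_zero' (Eventually.of_forall fun x => by positivity)
    (eventually_exp_neg_mul_exp_le hκ c) Real.tendsto_exp_neg_atTop_nhds_zero

/-- Cauchy's theorem on the rectangle between two Hankel contours of the same angle. -/
theorem hankelIntegral_shift {θ a b : ℝ} {f : ℂ → ℂ} (hab : a ≤ b)
    (hf : DifferentiableOn ℂ f (Icc a b ×ℂ Icc (-θ) θ)) (hθ : 0 ≤ θ)
    (h₁ : IntegrableOn (fun x : ℝ => f (x + θ * I)) (Ioi a))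
    (h₂ : IntegrableOn (fun x : ℝ => f (x - θ * I)) (Ioi a)) :
    hankelIntegral θ a f = hankelIntegral θ b f := by
  have hrect := integral_boundary_rect_eq_zero_of_differentiableOn f (⟨a, -θ⟩) (⟨b, θ⟩)
    (by simpa [uIcc_of_le hab, uIcc_of_le (by linarith : -θ ≤ θ)] using hf)
  have hsub : Ioc a b ⊆ Ioi a := fun x hx => hx.1
  have hb : Ioi b ⊆ Ioi a := Ioi_subset_Ioi hab
  have i₁ : IntervalIntegrable (fun x : ℝ => f (x + θ * I)) volume a b :=
    (intervalIntegrable_iff_integrableOn_Ioc_of_le hab).2 (h₁.mono_set hsub)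
  have i₂ : IntervalIntegrable (fun x : ℝ => f (x - θ * I)) volume a b :=
    (intervalIntegrable_iff_integrableOn_Ioc_of_le hab).2 (h₂.mono_set hsub)
  have hsplit := intervalIntegral.integral_interval_add_Ioi (h₁.sub h₂)
    ((h₁.sub h₂).mono_set hb)
  simp only [Pi.sub_apply] at hsplit
  rw [intervalIntegral.integral_sub i₁ i₂] at hsplit
  simp only [ofReal_neg, neg_mul, ← sub_eq_add_neg, smul_eq_mul] at hrect
  unfold hankelIntegral
  rw [← hsplit]
  linear_combination -hrect

/-- Cauchy's theorem on the half strip `re w > a`, `c < im w < d`, for a function that decays as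
`re w → ∞`. -/
theorem integral_ray_sub_integral_ray {a c d κ u : ℝ} {f : ℂ → ℂ} (hcd : c ≤ d) (hκ : 0 < κ)
    (hf : Differentiable ℂ f)
    (hbound : ∀ x : ℝ, ∀ y ∈ Icc c d,
      ‖f (x + y * I)‖ ≤ Real.exp (-κ * Real.exp x) * Real.exp (u * x)) :
    (∫ x in Ioi a, f (x + c * I)) - (∫ x in Ioi a, f (x + d * I)) =
      I * ∫ y in c..d, f (a + y * I) := by
  have hcont := hf.continuous
  have hint : ∀ y ∈ Icc c d, IntegrableOn (fun x : ℝ => f (x + y * I)) (Ioi a) := fun y hy =>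
    (integrableOn_exp_neg_mul_exp hκ u a).mono' (by fun_prop)
      (Eventually.of_forall fun x => hbound x y hy)
  have hlim : ∀ y ∈ Icc c d, Tendsto (fun R => ∫ x in a..R, f (x + y * I)) atTop
      (𝓝 (∫ x in Ioi a, f (x + y * I))) := fun y hy =>
    intervalIntegral_tendsto_integral_Ioi a (hint y hy) tendsto_id
  have hvert : Tendsto (fun R : ℝ => ∫ y in c..d, f (R + y * I)) atTop (𝓝 0) := by
    refine squeeze_zero_norm (fun R => intervalIntegral.norm_integral_le_of_norm_le_const
      (C := Real.exp (-κ * Real.exp R) * Real.exp (u * R)) fun y hy => hbound R y ?_) ?_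
    · rw [uIoc_of_le hcd] at hy; exact Ioc_subset_Icc_self hy
    · simpa using (tendsto_exp_neg_mul_exp hκ u).mul_const |d - c|
  have hrect : ∀ R : ℝ, (∫ x in a..R, f (x + c * I)) - (∫ x in a..R, f (x + d * I)) +
      I * (∫ y in c..d, f (R + y * I)) = I * ∫ y in c..d, f (a + y * I) := fun R => by
    have := integral_boundary_rect_eq_zero_of_differentiableOn f (⟨a, c⟩) (⟨R, d⟩)
      hf.differentiableOn
    simp only [smul_eq_mul] at this
    linear_combination this
  have := ((hlim c ⟨le_rfl, hcd⟩).sub (hlim d ⟨hcd, le_rfl⟩)).add (hvert.const_mul I)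
  simp only [hrect, mul_zero, add_zero] at this
  exact tendsto_nhds_unique this tendsto_const_nhds

/-- The integrand of Hankel's formula for `1 / Γ (1 - u)`, in the coordinate `w = log s`. -/
noncomputable def hankelKernel (u : ℝ) (w : ℂ) : ℂ := cexp (cexp w) * cexp (u * w)

theorem differentiable_hankelKernel (u : ℝ) : Differentiable ℂ (hankelKernel u) := by
  unfold hankelKernel; fun_prop

theorem continuous_hankelKernel (u : ℝ) : Continuous (hankelKernel u) :=
  (differentiable_hankelKernel u).continuous

theorem norm_cexp_ofReal_mul (u x y : ℝ) : ‖cexp (u * (x + y * I))‖ = Real.exp (u * x) := by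
  simp [Complex.norm_exp]

theorem norm_hankelKernel_le {u x y κ : ℝ} (h : Real.cos y ≤ -κ) :
    ‖hankelKernel u (x + y * I)‖ ≤ Real.exp (-κ * Real.exp x) * Real.exp (u * x) := by
  rw [hankelKernel, norm_mul, norm_cexp_ofReal_mul]
  gcongr
  exact norm_exp_exp_le h

theorem integrableOn_ray_hankelKernel {y : ℝ} (hy : Real.cos y < 0) (u a : ℝ) :
    IntegrableOn (fun x : ℝ => hankelKernel u (x + y * I)) (Ioi a) := by
  have := continuous_hankelKernel u
  exact (integrableOn_exp_neg_mul_exp (neg_pos.2 hy) u a).mono' (by fun_prop)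
    (Eventually.of_forall fun x => norm_hankelKernel_le (by simp))

theorem integrableOn_ray_hankelKernel' {y : ℝ} (hy : Real.cos y < 0) (u a : ℝ) :
    IntegrableOn (fun x : ℝ => hankelKernel u (x - y * I)) (Ioi a) := by
  simpa [sub_eq_add_neg] using integrableOn_ray_hankelKernel (y := -y) (by simpa) u a

theorem cos_neg_of_mem {θ : ℝ} (h₁ : Real.pi / 2 < θ) (h₂ : θ ≤ Real.pi) : Real.cos θ < 0 :=
  Real.cos_neg_of_pi_div_two_lt_of_lt h₁ (by linarith [Real.pi_pos])

/-- The rays of a Hankel contour can be opened up to the negative real axis. -/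
theorem hankelIntegral_hankelKernel_eq_pi {θ : ℝ} (h₁ : Real.pi / 2 < θ) (h₂ : θ ≤ Real.pi)
    (a u : ℝ) :
    hankelIntegral θ a (hankelKernel u) = hankelIntegral Real.pi a (hankelKernel u) := by
  have hc := cos_neg_of_mem h₁ h₂
  have hpi : Real.cos Real.pi < 0 := by simp
  have hb : ∀ y ∈ Icc θ Real.pi, Real.cos y ≤ -(-Real.cos θ) := fun y hy => by
    rw [neg_neg]
    exact Real.cos_le_cos_of_nonneg_of_le_pi (by linarith [Real.pi_pos]) hy.2 hy.1
  have e₁ := integral_ray_sub_integral_ray (a := a) (u := u) h₂ (neg_pos.2 hc)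
    (differentiable_hankelKernel u) fun x y hy => norm_hankelKernel_le (hb y hy)
  have e₂ := integral_ray_sub_integral_ray (a := a) (u := u) (neg_le_neg h₂) (neg_pos.2 hc)
    (differentiable_hankelKernel u) fun x y hy => norm_hankelKernel_le (y := y) (by
      rw [← Real.cos_neg]
      exact hb (-y) ⟨by linarith [hy.2], by linarith [hy.1]⟩)
  have hk := continuous_hankelKernel u
  have hi : ∀ p q : ℝ, IntervalIntegrable (fun y : ℝ => hankelKernel u (a + y * I)) volume p q :=
    fun p q => Continuous.intervalIntegrable (by fun_prop) _ _
  have s₁ := intervalIntegral.integral_add_adjacent_intervals (hi (-Real.pi) (-θ)) (hi (-θ) θ)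
  have s₂ := intervalIntegral.integral_add_adjacent_intervals (hi (-Real.pi) θ) (hi θ Real.pi)
  unfold hankelIntegral
  rw [integral_sub (integrableOn_ray_hankelKernel hc u a) (integrableOn_ray_hankelKernel' hc u a),
    integral_sub (integrableOn_ray_hankelKernel hpi u a)
      (integrableOn_ray_hankelKernel' hpi u a), ← s₂, ← s₁]
  simp only [ofReal_neg, neg_mul, ← sub_eq_add_neg] at e₂
  linear_combination e₁ + e₂

theorem hankelIntegral_hankelKernel_eq {θ : ℝ} (h₁ : Real.pi / 2 < θ) (h₂ : θ ≤ Real.pi)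
    (a b u : ℝ) :
    hankelIntegral θ a (hankelKernel u) = hankelIntegral θ b (hankelKernel u) := by
  wlog hab : a ≤ b generalizing a b
  · exact (this b a (le_of_not_ge hab)).symm
  have hc := cos_neg_of_mem h₁ h₂
  exact hankelIntegral_shift hab (differentiable_hankelKernel u).differentiableOn
    (by linarith [Real.pi_pos]) (integrableOn_ray_hankelKernel hc u a)
    (integrableOn_ray_hankelKernel' hc u a)

theorem integrable_exp_neg_exp_mul_exp {u : ℝ} (hu : 0 < u) :
    Integrable fun x : ℝ => Real.exp (-Real.exp x) * Real.exp (u * x) := by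
  have := integrableOn_image_iff_integrableOn_abs_deriv_smul MeasurableSet.univ
    (fun x _ => (Real.hasDerivAt_exp x).hasDerivWithinAt) Real.exp_injective.injOn
    fun x => Real.exp (-x) * x ^ (u - 1)
  rw [image_univ, Real.range_exp, integrableOn_univ] at this
  refine (this.1 (Real.GammaIntegral_convergent hu)).congr (Eventually.of_forall fun x => ?_)
  simp only [smul_eq_mul, abs_of_pos (Real.exp_pos x), ← Real.exp_mul, ← Real.exp_add]
  ring_nf

theorem integral_exp_neg_exp_mul_exp {u : ℝ} (hu : 0 < u) :
    ∫ x : ℝ, Real.exp (-Real.exp x) * Real.exp (u * x) = Real.Gamma u := by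
  have := integral_image_eq_integral_abs_deriv_smul MeasurableSet.univ
    (fun x _ => (Real.hasDerivAt_exp x).hasDerivWithinAt) Real.exp_injective.injOn
    fun x => Real.exp (-x) * x ^ (u - 1)
  rw [image_univ, Real.range_exp, setIntegral_univ, ← Real.Gamma_eq_integral hu] at this
  rw [this]
  refine integral_congr_ae (Eventually.of_forall fun x => ?_)
  simp only [smul_eq_mul, abs_of_pos (Real.exp_pos x), ← Real.exp_mul, ← Real.exp_add]
  ring_nf

/-- On the two sides of the negative real axis the integrand `exp s * s ^ (u - 1)` differs by a
phase. -/
theorem hankelKernel_pi_sub (u x : ℝ) :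
    hankelKernel u (x + Real.pi * I) - hankelKernel u (x - Real.pi * I) =
      2 * I * Real.sin (Real.pi * u) *
        ((Real.exp (-Real.exp x) * Real.exp (u * x) : ℝ) : ℂ) := by
  have h₁ : cexp (x + Real.pi * I) = -cexp x := by simp [Complex.exp_add]
  have h₂ : cexp (x - Real.pi * I) = -cexp x := by
    simp [sub_eq_add_neg, Complex.exp_add, Complex.exp_neg]
  have h₃ : cexp (u * (x + Real.pi * I)) = cexp (u * x) * cexp ((Real.pi * u : ℂ) * I) := by
    rw [← Complex.exp_add]; ring_nf
  have h₄ : cexp (u * (x - Real.pi * I)) = cexp (u * x) * cexp (-(Real.pi * u : ℂ) * I) := by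
    rw [← Complex.exp_add]; ring_nf
  rw [hankelKernel, hankelKernel, h₁, h₂, h₃, h₄]
  push_cast
  rw [show 2 * I * Complex.sin (Real.pi * u) =
    cexp ((Real.pi * u : ℂ) * I) - cexp (-(Real.pi * u : ℂ) * I) by
      rw [Complex.sin]; ring_nf; simp]
  ring

/-- The mean value property on the circle `|s| = exp a`. -/
theorem hankelIntegral_hankelKernel_zero (a : ℝ) :
    hankelIntegral Real.pi a (hankelKernel 0) = 2 * Real.pi * I := by
  have hmean : Real.circleAverage cexp 0 (Real.exp a) = 1 := by
    simpa using (Differentiable.diffContOnCl (s := Metric.ball 0 |Real.exp a|)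
      Complex.differentiable_exp).circleAverage
  have hper : Function.Periodic (fun y : ℝ => hankelKernel 0 (a + y * I)) (2 * Real.pi) := by
    intro y
    have : cexp (a + ((y + 2 * Real.pi : ℝ) : ℂ) * I) = cexp (a + y * I) := by
      push_cast
      rw [add_mul, ← add_assoc, Complex.exp_periodic]
    simp only [hankelKernel, this]
    simp
  have hint := hper.intervalIntegral_add_eq (-Real.pi) 0
  rw [show -Real.pi + 2 * Real.pi = Real.pi by ring, zero_add] at hint
  have hcirc : ∫ y in (0 : ℝ)..2 * Real.pi, hankelKernel 0 (a + y * I) = 2 * Real.pi := by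
    rw [Real.circleAverage_def, inv_smul_eq_iff₀ (by positivity)] at hmean
    simpa [circleMap, hankelKernel, Complex.exp_add] using hmean
  have hray (x : ℝ) := hankelKernel_pi_sub 0 x
  simp only [mul_zero, Real.sin_zero, ofReal_zero, zero_mul] at hray
  rw [hankelIntegral, hint, hcirc]
  simp only [hray, integral_zero]
  ring

/-- As the radius `exp a` of the arc tends to `0`, Hankel's integral tends to Euler's integral
for `Γ u` times the jump of the phase; the reflection formula turns this into `1 / Γ (1 - u)`. -/
theorem hankelIntegral_hankelKernel_pos {u : ℝ} (hu₀ : 0 < u) (hu₁ : u < 1) (a : ℝ) :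
    hankelIntegral Real.pi a (hankelKernel u) = 2 * Real.pi * I / Real.Gamma (1 - u) := by
  have hpi := Real.pi_pos
  have hcont := continuous_hankelKernel u
  have hrays : Tendsto (fun b : ℝ => ∫ x in Ioi b,
      (hankelKernel u (x + Real.pi * I) - hankelKernel u (x - Real.pi * I))) atBot
      (𝓝 (2 * I * Real.sin (Real.pi * u) * Real.Gamma u)) := by
    simp only [hankelKernel_pi_sub]
    rw [← integral_exp_neg_exp_mul_exp hu₀, ← integral_complex_ofReal, ← integral_const_mul]
    exact (aecover_Ioi tendsto_id).integral_tendsto_of_countably_generated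
      ((integrable_exp_neg_exp_mul_exp hu₀).ofReal.const_mul _)
  have harc : Tendsto (fun b : ℝ => ∫ y in (-Real.pi)..Real.pi, hankelKernel u (b + y * I)) atBot
      (𝓝 0) := by
    have hlim : Tendsto (fun b : ℝ => Real.exp 1 * Real.exp (u * b) * |Real.pi - -Real.pi|) atBot
        (𝓝 0) := by
      have := Real.tendsto_exp_atBot.comp (tendsto_id.const_mul_atBot hu₀)
      simpa using (this.const_mul (Real.exp 1)).mul_const |Real.pi - -Real.pi|
    refine squeeze_zero_norm' ?_ hlim
    filter_upwards [eventually_le_atBot 0] with b hb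
    refine intervalIntegral.norm_integral_le_of_norm_le_const fun y _ => ?_
    rw [hankelKernel, norm_mul, norm_cexp_ofReal_mul, norm_exp_exp]
    gcongr
    exact (mul_le_of_le_one_right (Real.exp_pos b).le (Real.cos_le_one y)).trans
      (Real.exp_le_one_iff.2 hb)
  have hlim := hrays.add (harc.const_mul I)
  have hconst : ∀ b, hankelIntegral Real.pi b (hankelKernel u) =
      hankelIntegral Real.pi a (hankelKernel u) := fun b =>
    hankelIntegral_hankelKernel_eq (by linarith) le_rfl b a u
  have heq := tendsto_nhds_unique tendsto_const_nhds (hlim.congr hconst)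
  have hrefl := Real.Gamma_mul_Gamma_one_sub u
  have hsin : Real.sin (Real.pi * u) ≠ 0 :=
    (Real.sin_pos_of_pos_of_lt_pi (by positivity) (by nlinarith)).ne'
  have hG : Real.Gamma (1 - u) ≠ 0 := (Real.Gamma_pos_of_pos (by linarith)).ne'
  rw [eq_div_iff hsin] at hrefl
  have hrefl' : (Real.Gamma u * Real.Gamma (1 - u) * Real.sin (Real.pi * u) : ℂ) = Real.pi := by
    exact_mod_cast hrefl
  have hG' : (Real.Gamma (1 - u) : ℂ) ≠ 0 := by exact_mod_cast hG
  rw [heq, eq_div_iff hG']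
  linear_combination 2 * I * hrefl'

theorem hasDerivAt_hankelKernel (u : ℝ) (w : ℂ) :
    HasDerivAt (hankelKernel u) (hankelKernel (u + 1) w + u * hankelKernel u w) w := by
  have h₁ : HasDerivAt (fun w => cexp (cexp w)) (cexp (cexp w) * cexp w) w :=
    (Complex.hasDerivAt_exp w).cexp
  have h₂ : HasDerivAt (fun w => cexp (u * w)) (cexp (u * w) * u) w := by
    simpa using ((hasDerivAt_id w).const_mul (u : ℂ)).cexp
  refine (h₁.mul h₂).congr_deriv ?_
  simp only [hankelKernel, ofReal_add, ofReal_one, add_mul, one_mul, Complex.exp_add]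
  ring

/-- Integration by parts along the contour: the analogue of `Γ (s + 1) = s * Γ s`. -/
theorem hankelIntegral_hankelKernel_add_one {θ : ℝ} (h₁ : Real.pi / 2 < θ) (h₂ : θ ≤ Real.pi)
    (a u : ℝ) :
    hankelIntegral θ a (hankelKernel (u + 1)) = -u * hankelIntegral θ a (hankelKernel u) := by
  have hc := cos_neg_of_mem h₁ h₂
  have hk := continuous_hankelKernel u
  have hk' := continuous_hankelKernel (u + 1)
  have hray : ∀ y : ℝ, Real.cos y < 0 →
      (∫ x in Ioi a, hankelKernel (u + 1) (x + y * I)) +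
        u * (∫ x in Ioi a, hankelKernel u (x + y * I)) = -hankelKernel u (a + y * I) := by
    intro y hy
    have i₁ := integrableOn_ray_hankelKernel hy (u + 1) a
    have i₂ := (integrableOn_ray_hankelKernel hy u a).const_mul (u : ℂ)
    have hlim : Tendsto (fun x : ℝ => hankelKernel u (x + y * I)) atTop (𝓝 0) :=
      squeeze_zero_norm (fun x => norm_hankelKernel_le (by simp))
        (tendsto_exp_neg_mul_exp (neg_pos.2 hy) u)
    rw [← integral_const_mul, ← integral_add i₁ i₂, integral_Ioi_of_hasDerivAt_of_tendsto'
      (fun x _ => ((hasDerivAt_hankelKernel u _).comp_add_const (x : ℂ) (y * I)).comp_ofReal)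
      (i₁.add i₂) hlim, zero_sub]
  have harc : I * (∫ y in (-θ)..θ, hankelKernel (u + 1) (a + y * I)) +
      u * (I * ∫ y in (-θ)..θ, hankelKernel u (a + y * I)) =
        hankelKernel u (a + θ * I) - hankelKernel u (a - θ * I) := by
    have hd : ∀ y : ℝ, HasDerivAt (fun y : ℝ => hankelKernel u (a + y * I))
        ((hankelKernel (u + 1) (a + y * I) + u * hankelKernel u (a + y * I)) * I) y := fun y => by
      have hlin : HasDerivAt (fun z : ℂ => a + z * I) I (y : ℂ) := by
        simpa using ((hasDerivAt_id (y : ℂ)).mul_const I).const_add (a : ℂ)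
      exact ((hasDerivAt_hankelKernel u _).comp (y : ℂ) hlin).comp_ofReal
    have := intervalIntegral.integral_eq_sub_of_hasDerivAt (fun y _ => hd y)
      (Continuous.intervalIntegrable (by fun_prop) (-θ) θ)
    rw [intervalIntegral.integral_mul_const, intervalIntegral.integral_add
      (Continuous.intervalIntegrable (by fun_prop) _ _)
      (Continuous.intervalIntegrable (by fun_prop) _ _),
      intervalIntegral.integral_const_mul] at this
    simp only [ofReal_neg, neg_mul, ← sub_eq_add_neg] at this
    linear_combination this
  have r₁ := hray θ hc
  have r₂ := hray (-θ) (by simpa)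
  simp only [ofReal_neg, neg_mul, ← sub_eq_add_neg] at r₂
  unfold hankelIntegral
  rw [integral_sub (integrableOn_ray_hankelKernel hc _ a) (integrableOn_ray_hankelKernel' hc _ a),
    integral_sub (integrableOn_ray_hankelKernel hc _ a) (integrableOn_ray_hankelKernel' hc _ a)]
  linear_combination r₁ - r₂ + harc

/-- **Hankel's formula** for the reciprocal Gamma function. -/
theorem hankelIntegral_hankelKernel {θ : ℝ} (h₁ : Real.pi / 2 < θ) (h₂ : θ ≤ Real.pi)
    (a : ℝ) {u : ℝ} (hu : u < 1) :
    hankelIntegral θ a (hankelKernel u) = 2 * Real.pi * I / Real.Gamma (1 - u) := by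
  obtain ⟨m, hm⟩ := exists_nat_gt (-u)
  induction m generalizing u with
  | zero =>
    rw [hankelIntegral_hankelKernel_eq_pi h₁ h₂]
    exact hankelIntegral_hankelKernel_pos (by simpa using hm) hu a
  | succ m ih =>
    rcases lt_trichotomy u 0 with h | rfl | h
    · have h0 := ih (u := u + 1) (by linarith) (by push_cast at hm; linarith)
      rw [hankelIntegral_hankelKernel_add_one h₁ h₂] at h0
      have hG : Real.Gamma (1 - u) = -u * Real.Gamma (-u) := by
        rw [← Real.Gamma_add_one (by linarith)]; ring_nf
      rw [show 1 - (u + 1) = -u by ring] at h0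
      have hu' : (u : ℂ) ≠ 0 := by exact_mod_cast h.ne
      have hg : (Real.Gamma (-u) : ℂ) ≠ 0 := by
        exact_mod_cast (Real.Gamma_pos_of_pos (by linarith)).ne'
      rw [hG]
      push_cast at h0 ⊢
      field_simp at h0 ⊢
      linear_combination -h0
    · rw [hankelIntegral_hankelKernel_eq_pi h₁ h₂, hankelIntegral_hankelKernel_zero]
      simp
    · rw [hankelIntegral_hankelKernel_eq_pi h₁ h₂]
      exact hankelIntegral_hankelKernel_pos h hu a

end HankelContour

/-! ### Decay of the Mittag-Leffler function on the imaginary axis -/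

section MittagLeffler

open Set Filter Topology Complex

theorem norm_hankelIntegral_le {θ a D : ℝ} {f : ℂ → ℂ} {b : ℝ → ℝ} (hθ : 0 ≤ θ)
    (hb : IntegrableOn b (Ioi a))
    (h₁ : ∀ x ∈ Ioi a, ‖f (x + θ * I)‖ ≤ b x) (h₂ : ∀ x ∈ Ioi a, ‖f (x - θ * I)‖ ≤ b x)
    (h₃ : ∀ y ∈ Icc (-θ) θ, ‖f (a + y * I)‖ ≤ D) :
    ‖hankelIntegral θ a f‖ ≤ (∫ x in Ioi a, 2 * b x) + D * (2 * θ) := by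
  have hrays : ‖∫ x in Ioi a, (f (x + θ * I) - f (x - θ * I))‖ ≤ ∫ x in Ioi a, 2 * b x := by
    refine norm_integral_le_of_norm_le (hb.const_mul 2) ?_
    filter_upwards [ae_restrict_mem measurableSet_Ioi] with x hx
    linarith [norm_sub_le (f (x + θ * I)) (f (x - θ * I)), h₁ x hx, h₂ x hx]
  have harc : ‖∫ y in (-θ)..θ, f (a + y * I)‖ ≤ D * (2 * θ) := by
    refine (intervalIntegral.norm_integral_le_of_norm_le_const fun y hy => h₃ y ?_).trans_eq ?_
    · rw [uIoc_of_le (by linarith)] at hy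
      exact Ioc_subset_Icc_self hy
    · rw [abs_of_nonneg (by linarith)]; ring
  refine (norm_add_le _ _).trans (add_le_add hrays ?_)
  rwa [norm_mul, norm_I, one_mul]

theorem hasSum_hankelIntegral {θ a : ℝ} (h₁ : Real.pi / 2 < θ) (h₂ : θ ≤ Real.pi)
    {F : ℕ → ℂ → ℂ} {f : ℂ → ℂ} (hF : ∀ k, Continuous (F k))
    (hbound : ∀ k : ℕ, ∀ x y : ℝ, a ≤ x →
      ‖F k (x + y * I)‖ ≤ ‖cexp (cexp (x + y * I))‖ * (1 / 2) ^ k)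
    (hlim : ∀ x y : ℝ, a ≤ x → HasSum (fun k => F k (x + y * I)) (f (x + y * I))) :
    HasSum (fun k => hankelIntegral θ a (F k)) (hankelIntegral θ a f) := by
  have hc := cos_neg_of_mem h₁ h₂
  have hray (x y : ℝ) (hx : a ≤ x) (k : ℕ) (hy : Real.cos y ≤ -(-Real.cos θ)) :
      ‖F k (x + y * I)‖ ≤ Real.exp (-(-Real.cos θ) * Real.exp x) * (1 / 2) ^ k :=
    (hbound k x y hx).trans (by gcongr; exact norm_exp_exp_le hy)
  have hE : IntegrableOn (fun x => Real.exp (-(-Real.cos θ) * Real.exp x)) (Ioi a) := by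
    simpa using integrableOn_exp_neg_mul_exp (neg_pos.2 hc) 0 a
  have hneg : ∀ x : ℝ, (x - θ * I : ℂ) = x + (-θ : ℝ) * I := fun x => by push_cast; ring
  have hgeom : Summable fun k : ℕ => (1 / 2 : ℝ) ^ k := summable_geometric_two
  refine HasSum.add ?_ (HasSum.mul_left I ?_)
  · refine hasSum_integral_of_dominated_convergence
      (fun k x => 2 * Real.exp (-(-Real.cos θ) * Real.exp x) * (1 / 2) ^ k) (fun k => ?_)
      (fun k => ?_) (Eventually.of_forall fun x => hgeom.mul_left _) ?_ ?_
    · have := hF k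
      exact Continuous.aestronglyMeasurable (by fun_prop)
    · filter_upwards [ae_restrict_mem measurableSet_Ioi] with x hx
      rw [hneg]
      have e₁ := hray x θ (le_of_lt hx) k (by simp)
      have e₂ := hray x (-θ) (le_of_lt hx) k (by simp)
      linarith [norm_sub_le (F k (x + θ * I)) (F k (x + (-θ : ℝ) * I))]
    · exact ((hE.const_mul 2).mul_const (∑' k : ℕ, (1 / 2 : ℝ) ^ k)).congr
        (Eventually.of_forall fun x => tsum_mul_left.symm)
    · filter_upwards [ae_restrict_mem measurableSet_Ioi] with x hx
      rw [hneg]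
      exact (hlim x θ (le_of_lt hx)).sub (hlim x (-θ) (le_of_lt hx))
  · refine intervalIntegral.hasSum_integral_of_dominated_convergence
      (fun k y => Real.exp (Real.exp a) * (1 / 2) ^ k) (fun k => ?_)
      (fun k => ?_) (Eventually.of_forall fun x _ => hgeom.mul_left _) ?_ ?_
    · have := hF k
      exact Continuous.aestronglyMeasurable (by fun_prop)
    · refine Eventually.of_forall fun y _ => (hbound k a y le_rfl).trans ?_
      rw [norm_exp_exp]
      gcongr
      exact mul_le_of_le_one_right (Real.exp_pos a).le (Real.cos_le_one y)
    · exact intervalIntegrable_const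
    · exact Eventually.of_forall fun y _ => hlim a y le_rfl

/-- The integrand of Hankel's formula for `E_α(z)`, in the coordinate `w = log s`. -/
noncomputable def mittagLefflerKernel (α : ℝ) (z w : ℂ) : ℂ :=
  cexp (cexp w) * (cexp (α * w) / (cexp (α * w) - z))

/-- On a contour whose arc is so large that `|z| ≤ |s| ^ α / 2`, expand the integrand into a
geometric series and integrate term by term with Hankel's formula for `1 / Γ`. -/
theorem hasSum_mittagLeffler {α θ a : ℝ} (hα : 0 < α) (h₁ : Real.pi / 2 < θ) (h₂ : θ ≤ Real.pi)
    {z : ℂ} (hz : 2 * ‖z‖ ≤ Real.exp (α * a)) :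
    HasSum (fun k : ℕ => z ^ k / (Real.Gamma (α * k + 1) : ℂ))
      ((2 * Real.pi * I)⁻¹ * hankelIntegral θ a (mittagLefflerKernel α z)) := by
  have hq : ∀ x y : ℝ, a ≤ x → ‖z / cexp (α * (x + y * I))‖ ≤ 1 / 2 := fun x y hx => by
    rw [norm_div, norm_cexp_ofReal_mul, div_le_iff₀ (Real.exp_pos _)]
    have : Real.exp (α * a) ≤ Real.exp (α * x) := by gcongr
    linarith
  have hsum := hasSum_hankelIntegral (a := a) h₁ h₂
    (F := fun k w => cexp (cexp w) * (z / cexp (α * w)) ^ k) (f := mittagLefflerKernel α z)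
    (fun k => by
      have : ∀ w : ℂ, cexp (α * w) ≠ 0 := fun w => Complex.exp_ne_zero _
      fun_prop (disch := assumption))
    (fun k x y hx => by
      rw [norm_mul, norm_pow]
      gcongr
      exact hq x y hx)
    (fun x y hx => by
      have hlt : ‖z / cexp (α * (x + y * I))‖ < 1 := (hq x y hx).trans_lt (by norm_num)
      have hne : cexp (α * (x + y * I)) ≠ 0 := Complex.exp_ne_zero _
      have := (hasSum_geometric_of_norm_lt_one hlt).mul_left (cexp (cexp (x + y * I)))
      rwa [one_sub_div hne, inv_div] at this)
  refine (hsum.mul_left (2 * Real.pi * I : ℂ)⁻¹).congr_fun ?_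
  intro k
  have hk : (fun w => cexp (cexp w) * (z / cexp (α * w)) ^ k) =
      fun w => z ^ k * hankelKernel (-(α * k)) w := by
    funext w
    rw [hankelKernel, div_pow, ← Complex.exp_nat_mul, div_eq_mul_inv, ← Complex.exp_neg]
    push_cast
    ring_nf
  have hmul : ∀ f : ℂ → ℂ, hankelIntegral θ a (fun w => z ^ k * f w) =
      z ^ k * hankelIntegral θ a f := fun f => by
    unfold hankelIntegral
    simp only [← mul_sub, integral_const_mul, intervalIntegral.integral_const_mul]
    ring
  have hpos : 0 ≤ α * k := by positivity
  rw [hk, hmul, hankelIntegral_hankelKernel h₁ h₂ a (by linarith), sub_neg_eq_add, add_comm 1]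
  have : (2 * Real.pi * I : ℂ) ≠ 0 := by simp [Real.pi_ne_zero]
  field_simp

/-- The points of the sector `|arg| ≤ α θ < π / 2` outside the unit disc stay away from the
negative imaginary axis. -/
theorem norm_exp_add_I_mul_ge {α θ s x y : ℝ} (hα : 0 < α) (hαθ : α * θ < Real.pi / 2)
    (hx : 0 ≤ x) (hy : |y| ≤ θ) :
    Real.cos (α * θ) * (1 + s) / 2 ≤ ‖cexp (α * (x + y * I)) - -I * s‖ := by
  set ρ := Real.exp (α * x)
  set c := Real.cos (α * θ)
  have hθ : 0 ≤ θ := (abs_nonneg y).trans hy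
  have hρ : 1 ≤ ρ := Real.one_le_exp (by positivity)
  have hc : 0 < c := Real.cos_pos_of_mem_Ioo ⟨by nlinarith [Real.pi_pos], hαθ⟩
  have hcy : c ≤ Real.cos (α * y) := by
    rw [← Real.cos_abs (α * y), abs_mul, abs_of_pos hα]
    exact Real.cos_le_cos_of_nonneg_of_le_pi (by positivity) (by linarith [Real.pi_pos])
      (by gcongr)
  have hsq : ‖cexp (α * (x + y * I)) - -I * s‖ ^ 2 =
      (ρ * Real.cos (α * y)) ^ 2 + (ρ * Real.sin (α * y) + s) ^ 2 := by
    rw [← Complex.normSq_eq_norm_sq, Complex.normSq_apply]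
    simp [Complex.exp_re, Complex.exp_im, ρ]
    ring
  refine le_of_sq_le_sq ?_ (norm_nonneg _)
  rw [hsq]
  have hcs := Real.sin_sq_add_cos_sq (α * y)
  have hc2 : c ^ 2 ≤ Real.cos (α * y) ^ 2 := by gcongr
  have e₁ : c ^ 2 * s ^ 2 ≤
      (ρ * Real.cos (α * y)) ^ 2 + (ρ * Real.sin (α * y) + s) ^ 2 := by
    have : (ρ * Real.cos (α * y)) ^ 2 + (ρ * Real.sin (α * y) + s) ^ 2 =
        Real.cos (α * y) ^ 2 * s ^ 2 + (s * Real.sin (α * y) + ρ) ^ 2 := by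
      linear_combination (ρ ^ 2 - s ^ 2) * hcs
    rw [this]
    exact (mul_le_mul_of_nonneg_right hc2 (sq_nonneg s)).trans
      (le_add_of_nonneg_right (sq_nonneg _))
  have e₂ : c ^ 2 * 1 ≤ (ρ * Real.cos (α * y)) ^ 2 + (ρ * Real.sin (α * y) + s) ^ 2 := by
    have : c * 1 ≤ Real.cos (α * y) * ρ := mul_le_mul hcy hρ zero_le_one (hc.le.trans hcy)
    nlinarith [sq_nonneg (ρ * Real.sin (α * y) + s)]
  nlinarith [mul_nonneg (sq_nonneg c) (sq_nonneg (1 - s))]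

/-- Algebraic decay of the Mittag-Leffler function on the negative imaginary axis. -/
theorem exists_norm_mittagLeffler_le {α : ℝ} (hα₀ : 0 < α) (hα₁ : α < 1) :
    ∃ C : ℝ, 0 < C ∧ ∀ s : ℝ, 0 ≤ s → ‖mittagLeffler α (-I * s)‖ ≤ C / (1 + s) := by
  have hpi := Real.pi_pos
  -- the rays lie in the half plane `re s < 0` while `s ^ α` stays in the right half plane
  obtain ⟨θ, h₁, hθ⟩ := exists_between (lt_min (show Real.pi / 2 < Real.pi by linarith)
    (show Real.pi / 2 < Real.pi / 2 / α by
      rw [lt_div_iff₀ hα₀]; nlinarith))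
  have h₂ : θ ≤ Real.pi := hθ.le.trans (min_le_left _ _)
  have hαθ : α * θ < Real.pi / 2 := by
    rw [mul_comm, ← lt_div_iff₀ hα₀]
    exact hθ.trans_le (min_le_right _ _)
  have hθ₀ : 0 < θ := by linarith
  have hcos := cos_neg_of_mem h₁ h₂
  have hc : 0 < Real.cos (α * θ) := Real.cos_pos_of_mem_Ioo ⟨by nlinarith, hαθ⟩
  set c := Real.cos (α * θ)
  set b : ℝ → ℝ := fun x => Real.exp (-(-Real.cos θ) * Real.exp x) * Real.exp (α * x)
  have hb : IntegrableOn b (Ioi 0) := integrableOn_exp_neg_mul_exp (neg_pos.2 hcos) α 0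
  set M : ℝ := (∫ x in Ioi 0, 2 * b x) + Real.exp 1 * (2 * θ)
  have hM : 0 < M := by
    have : 0 ≤ ∫ x in Ioi 0, 2 * b x := integral_nonneg fun x => by positivity
    positivity
  refine ⟨(2 * Real.pi)⁻¹ * (2 / c * M), by positivity, fun s hs => ?_⟩
  have hden := fun x y : ℝ => norm_exp_add_I_mul_ge (s := s) (x := x) (y := y) hα₀ hαθ
  have hden_pos : 0 < c * (1 + s) / 2 := by positivity
  have hker : ∀ x y : ℝ, 0 ≤ x → |y| ≤ θ → ‖mittagLefflerKernel α (-I * s) (x + y * I)‖ ≤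
      ‖cexp (cexp (x + y * I))‖ * Real.exp (α * x) * (2 / c / (1 + s)) := fun x y hx hy => by
    rw [mittagLefflerKernel, norm_mul, norm_div, norm_cexp_ofReal_mul, mul_assoc]
    gcongr
    rw [div_eq_mul_inv]
    gcongr
    refine (inv_anti₀ hden_pos (hden x y hx hy)).trans_eq ?_
    field_simp
  have hneg : ∀ x : ℝ, (x - θ * I : ℂ) = x + (-θ : ℝ) * I := fun x => by push_cast; ring
  have hray : ∀ x y : ℝ, 0 ≤ x → |y| = θ → ‖mittagLefflerKernel α (-I * s) (x + y * I)‖ ≤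
      b x * (2 / c / (1 + s)) := fun x y hx hy => by
    have hcy : Real.cos y ≤ -(-Real.cos θ) := by rw [neg_neg, ← hy, Real.cos_abs]
    refine (hker x y hx hy.le).trans ?_
    gcongr
    exact mul_le_mul_of_nonneg_right (norm_exp_exp_le hcy) (Real.exp_pos _).le
  have hθa : |θ| = θ := abs_of_pos hθ₀
  have hθa' : |-θ| = θ := by rw [abs_neg, hθa]
  -- the contour on which the series can be integrated
  set a := Real.log (2 * (1 + s)) / α
  have ha : 0 ≤ a := div_nonneg (Real.log_nonneg (by linarith)) hα₀.le
  have hea : Real.exp (α * a) = 2 * (1 + s) := by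
    rw [mul_div_cancel₀ _ hα₀.ne', Real.exp_log (by positivity)]
  have hne : ∀ x y : ℝ, 0 ≤ x → |y| ≤ θ → cexp (α * (x + y * I)) - -I * s ≠ 0 :=
    fun x y hx hy => norm_pos_iff.1 (hden_pos.trans_le (hden x y hx hy))
  have hmeas : ∀ y : ℝ, |y| = θ → IntegrableOn
      (fun x : ℝ => mittagLefflerKernel α (-I * s) (x + y * I)) (Ioi 0) := fun y hy => by
    refine (hb.mul_const (2 / c / (1 + s))).mono' ?_ ?_
    · refine ContinuousOn.aestronglyMeasurable ?_ measurableSet_Ioi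
      unfold mittagLefflerKernel
      exact ContinuousOn.mul (by fun_prop) (ContinuousOn.div (by fun_prop) (by fun_prop)
        fun x hx => hne x y (le_of_lt hx) hy.le)
    · filter_upwards [ae_restrict_mem measurableSet_Ioi] with x hx
      exact hray x y (le_of_lt hx) hy
  have hdiff : DifferentiableOn ℂ (mittagLefflerKernel α (-I * s)) (Icc 0 a ×ℂ Icc (-θ) θ) := by
    unfold mittagLefflerKernel
    refine DifferentiableOn.mul (by fun_prop) (DifferentiableOn.div (by fun_prop) (by fun_prop)
      fun w hw => ?_)
    rw [← Complex.re_add_im w]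
    exact hne w.re w.im hw.1.1 (abs_le.2 hw.2)
  have hsum := hasSum_mittagLeffler (a := a) (z := -I * s) hα₀ h₁ h₂ (by
    rw [hea, norm_mul, norm_neg, norm_I, one_mul, Complex.norm_real, Real.norm_of_nonneg hs]
    linarith)
  rw [mittagLeffler, hsum.tsum_eq, ← hankelIntegral_shift ha hdiff hθ₀.le (hmeas θ hθa)
    (by simpa only [hneg] using hmeas (-θ) hθa'), norm_mul]
  have hbound := norm_hankelIntegral_le (f := mittagLefflerKernel α (-I * s))
    (D := Real.exp 1 * (2 / c / (1 + s))) hθ₀.le (hb.mul_const (2 / c / (1 + s)))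
    (fun x hx => hray x θ (le_of_lt hx) hθa)
    (fun x hx => by rw [hneg]; exact hray x (-θ) (le_of_lt hx) hθa')
    (fun y hy => by
      refine (hker 0 y le_rfl (abs_le.2 hy)).trans ?_
      rw [norm_exp_exp, mul_zero, Real.exp_zero, mul_one, one_mul]
      gcongr
      exact Real.cos_le_one y)
  have hint : ∫ x in Ioi 0, 2 * (b x * (2 / c / (1 + s))) =
      (∫ x in Ioi 0, 2 * b x) * (2 / c / (1 + s)) := by
    rw [← integral_mul_const]
    simp only [mul_assoc]
  have hnorm : ‖(2 * Real.pi * I : ℂ)⁻¹‖ = (2 * Real.pi)⁻¹ := by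
    simp [abs_of_pos hpi]
  rw [hnorm, mul_div_assoc]
  gcongr
  refine hbound.trans_eq ?_
  rw [hint]
  simp only [M]
  ring

/-- The series defining `E_α` converges everywhere. -/
theorem hasSum_mittagLeffler_series {α : ℝ} (hα : 0 < α) (z : ℂ) :
    HasSum (fun k : ℕ => z ^ k / (Real.Gamma (α * k + 1) : ℂ)) (mittagLeffler α z) := by
  refine (hasSum_mittagLeffler (θ := Real.pi) (a := Real.log (2 * ‖z‖ + 1) / α) hα
    (by linarith [Real.pi_pos]) le_rfl ?_).summable.hasSum
  rw [mul_div_cancel₀ _ hα.ne', Real.exp_log (by positivity)]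
  linarith

theorem measurable_mittagLeffler {α : ℝ} (hα : 0 < α) : Measurable (mittagLeffler α) := by
  refine measurable_of_tendsto_metrizable
    (f := fun n z => ∑ k ∈ Finset.range n, z ^ k / (Real.Gamma (α * k + 1) : ℂ))
    (fun n => by fun_prop) ?_
  rw [tendsto_pi_nhds]
  exact fun z => (hasSum_mittagLeffler_series hα z).tendsto_sum_nat

end MittagLeffler

/-! ### Multipliers acting from `L¹` to `L^∞` -/

section FourierMultipliers

open Set Filter Topology

variable {n : ℕ}

theorem continuous_fourier_of_integrable {f : EuclideanSpace ℝ (Fin n) → ℂ} (hf : Integrable f) :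
    Continuous (𝓕 f) :=
  VectorFourier.fourierIntegral_continuous Real.continuous_fourierChar continuous_inner hf

theorem norm_fourier_le_integral_norm (f : EuclideanSpace ℝ (Fin n) → ℂ)
    (ξ : EuclideanSpace ℝ (Fin n)) : ‖𝓕 f ξ‖ ≤ ∫ x, ‖f x‖ :=
  VectorFourier.norm_fourierIntegral_le_integral_norm _ _ _ _ _

theorem boundedToDistribution_apply {f : EuclideanSpace ℝ (Fin n) → ℂ} (hf : MemLp f ∞ volume)
    (η : 𝓢(EuclideanSpace ℝ (Fin n), ℂ)) : boundedToDistribution f η = ∫ x, η x * f x := by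
  rw [boundedToDistribution, dif_pos hf, Lp.toTemperedDistribution_apply]
  refine integral_congr_ae ?_
  filter_upwards [hf.coeFn_toLp] with x hx
  rw [hx, smul_eq_mul]

/-- The Fourier transform is self-adjoint, so on an integrable function the distributional inverse
Fourier transform is the classical one, which is bounded by the `L¹` norm. -/
theorem exists_fourierInv_boundedToDistribution_eq {f : EuclideanSpace ℝ (Fin n) → ℂ}
    (hf : Integrable f) (hf' : MemLp f ∞ volume) :
    ∃ g : Lp ℂ ∞ (volume : Measure (EuclideanSpace ℝ (Fin n))),
      𝓕⁻ (boundedToDistribution f) = Lp.toTemperedDistribution g ∧ ‖g‖ ≤ ∫ x, ‖f x‖ := by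
  have hneg : Integrable fun x => f (-x) := hf.comp_neg
  have hbound : ∀ v, ‖𝓕 (fun x => f (-x)) v‖ ≤ ∫ x, ‖f x‖ := fun v => by
    refine (norm_fourier_le_integral_norm _ v).trans_eq ?_
    exact integral_neg_eq_self (fun x => ‖f x‖) volume
  have hmem : MemLp (𝓕 fun x => f (-x)) ∞ volume :=
    memLp_top_of_bound (continuous_fourier_of_integrable hneg).aestronglyMeasurable _
      (Eventually.of_forall hbound)
  refine ⟨hmem.toLp _, ?_, ?_⟩
  · ext η
    rw [TemperedDistribution.fourierInv_apply, boundedToDistribution_apply hf',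
      Lp.toTemperedDistribution_apply]
    have hflip : ∫ ξ, 𝓕 (fun x => f (-x)) ξ * η ξ = ∫ x, f (-x) * 𝓕 η x := by
      simpa using! VectorFourier.integral_fourierIntegral_smul_eq_flip
        (L := innerₗ (EuclideanSpace ℝ (Fin n))) Real.continuous_fourierChar continuous_inner
        hneg η.integrable
    calc ∫ x, 𝓕⁻ η x * f x = ∫ x, f (-x) * 𝓕 η x := by
          rw [← integral_neg_eq_self]
          refine integral_congr_ae (Eventually.of_forall fun x => ?_)
          simp only [SchwartzMap.fourierInv_coe, SchwartzMap.fourier_coe,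
            Real.fourierInv_eq_fourier_neg, neg_neg]
          ring
      _ = ∫ ξ, 𝓕 (fun x => f (-x)) ξ * η ξ := hflip.symm
      _ = ∫ ξ, η ξ • (hmem.toLp _ : EuclideanSpace ℝ (Fin n) → ℂ) ξ := by
          refine integral_congr_ae ?_
          filter_upwards [hmem.coeFn_toLp] with x hx
          rw [hx, smul_eq_mul, mul_comm]
  · rw [Lp.norm_toLp]
    refine ENNReal.toReal_le_of_le_ofReal (integral_nonneg fun x => norm_nonneg _) ?_
    rw [eLpNorm_exponent_top]
    exact eLpNormEssSup_le_of_ae_bound (Eventually.of_forall hbound)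

theorem fourierMultiplierCLM_fourierInv_boundedToDistribution
    {f ψ : EuclideanSpace ℝ (Fin n) → ℂ} (hψ : ψ.HasTemperateGrowth) (hf : MemLp f ∞ volume)
    (hψf : MemLp (fun ξ => ψ ξ * f ξ) ∞ volume) :
    TemperedDistribution.fourierMultiplierCLM ℂ ψ (𝓕⁻ (boundedToDistribution f)) =
      𝓕⁻ (boundedToDistribution fun ξ => ψ ξ * f ξ) := by
  rw [TemperedDistribution.fourierMultiplierCLM_apply, FourierTransform.fourier_fourierInv_eq]
  congr 1
  ext η
  rw [TemperedDistribution.smulLeftCLM_apply_apply, boundedToDistribution_apply hf,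
    boundedToDistribution_apply hψf]
  refine integral_congr_ae (Eventually.of_forall fun x => ?_)
  simp only [SchwartzMap.smulLeftCLM_apply_apply hψ, smul_eq_mul]
  ring

theorem norm_propagatorSymbol_le {α β t C : ℝ} (ht : 0 ≤ t)
    (hC : ∀ s : ℝ, 0 ≤ s → ‖mittagLeffler α (-Complex.I * s)‖ ≤ C / (1 + s))
    (ξ : EuclideanSpace ℝ (Fin n)) :
    ‖propagatorSymbol α β t ξ‖ ≤ C / (1 + t ^ α * ‖ξ‖ ^ β) :=
  hC _ (by positivity)

theorem measurable_propagatorSymbol {α : ℝ} (hα : 0 < α) (β t : ℝ) :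
    Measurable (propagatorSymbol α β t : EuclideanSpace ℝ (Fin n) → ℂ) := by
  unfold propagatorSymbol
  exact (measurable_mittagLeffler hα).comp (by fun_prop)

theorem norm_mul_fourier_le (m : EuclideanSpace ℝ (Fin n) → ℂ)
    (φ : Lp ℂ 1 (volume : Measure (EuclideanSpace ℝ (Fin n)))) (ξ : EuclideanSpace ℝ (Fin n)) :
    ‖m ξ * 𝓕 (φ : EuclideanSpace ℝ (Fin n) → ℂ) ξ‖ ≤ ‖m ξ‖ * ‖φ‖ := by
  rw [norm_mul, L1.norm_eq_integral_norm]
  gcongr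
  exact norm_fourier_le_integral_norm _ _

theorem aestronglyMeasurable_mul_fourier {m : EuclideanSpace ℝ (Fin n) → ℂ} (hm : Measurable m)
    (φ : Lp ℂ 1 (volume : Measure (EuclideanSpace ℝ (Fin n)))) :
    AEStronglyMeasurable (fun ξ => m ξ * 𝓕 (φ : EuclideanSpace ℝ (Fin n) → ℂ) ξ) volume :=
  hm.aestronglyMeasurable.mul
    (continuous_fourier_of_integrable (L1.integrable_coeFn φ)).aestronglyMeasurable

/-- A multiplier `m` in `L¹ ∩ L^∞` maps `L¹` to `L^∞` with norm at most `‖m‖₁`: its kernel is the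
inverse Fourier transform of `m`. -/
theorem exists_multiplier_eq {m : EuclideanSpace ℝ (Fin n) → ℂ} {b : EuclideanSpace ℝ (Fin n) → ℝ}
    {B : ℝ} (hm : Measurable m) (hB : ∀ ξ, ‖m ξ‖ ≤ B) (hb : Integrable b)
    (hmb : ∀ ξ, ‖m ξ‖ ≤ b ξ) (φ : Lp ℂ 1 (volume : Measure (EuclideanSpace ℝ (Fin n)))) :
    MemLp (fun ξ => m ξ * 𝓕 (φ : EuclideanSpace ℝ (Fin n) → ℂ) ξ) ∞ volume ∧
    ∃ g : Lp ℂ ∞ (volume : Measure (EuclideanSpace ℝ (Fin n))),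
      𝓕⁻ (boundedToDistribution fun ξ => m ξ * 𝓕 (φ : EuclideanSpace ℝ (Fin n) → ℂ) ξ) =
        Lp.toTemperedDistribution g ∧ ‖g‖ ≤ (∫ ξ, b ξ) * ‖φ‖ := by
  have hmeas := aestronglyMeasurable_mul_fourier hm φ
  have hle := norm_mul_fourier_le m φ
  have hmem : MemLp (fun ξ => m ξ * 𝓕 (φ : EuclideanSpace ℝ (Fin n) → ℂ) ξ) ∞ volume :=
    memLp_top_of_bound hmeas (B * ‖φ‖) (Eventually.of_forall fun ξ =>
      (hle ξ).trans (by gcongr; exact hB ξ))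
  have hle' : ∀ ξ, ‖m ξ * 𝓕 (φ : EuclideanSpace ℝ (Fin n) → ℂ) ξ‖ ≤ b ξ * ‖φ‖ := fun ξ =>
    (hle ξ).trans (by gcongr; exact hmb ξ)
  have hint := (hb.mul_const ‖φ‖).mono' hmeas (Eventually.of_forall hle')
  obtain ⟨g, hg, hgn⟩ := exists_fourierInv_boundedToDistribution_eq hint hmem
  refine ⟨hmem, g, hg, hgn.trans ?_⟩
  rw [← integral_mul_const]
  exact integral_mono hint.norm (hb.mul_const _) hle'

theorem memLp_propagatorHat {α β t C : ℝ} (hα : 0 < α) (hC₀ : 0 ≤ C) (ht : 0 ≤ t)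
    (hC : ∀ s : ℝ, 0 ≤ s → ‖mittagLeffler α (-Complex.I * s)‖ ≤ C / (1 + s))
    (φ : Lp ℂ 1 (volume : Measure (EuclideanSpace ℝ (Fin n)))) :
    MemLp (propagatorHat α β t φ) ∞ (volume : Measure (EuclideanSpace ℝ (Fin n))) := by
  refine memLp_top_of_bound (aestronglyMeasurable_mul_fourier
    ((measurable_propagatorSymbol hα β t).comp (measurable_const_smul (2 * Real.pi))) φ) (C * ‖φ‖)
    (Eventually.of_forall fun ξ => (norm_mul_fourier_le
      (fun ξ => propagatorSymbol α β t ((2 * Real.pi) • ξ)) φ ξ).trans ?_)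
  gcongr
  refine (norm_propagatorSymbol_le ht hC _).trans (div_le_self hC₀ ?_)
  have : 0 ≤ t ^ α * ‖(2 * Real.pi) • ξ‖ ^ β := by positivity
  linarith

end FourierMultipliers

/-! ### Dyadic localisation of the symbol -/

section Dyadic

open Set Filter Topology

variable {n : ℕ} {χ : EuclideanSpace ℝ (Fin n) → ℂ}

theorem IsCutoff.hasCompactSupport (hχ : IsCutoff χ) : HasCompactSupport χ :=
  HasCompactSupport.intro (isCompact_closedBall 0 2) fun ξ hξ => hχ.eq_zero ξ (by
    rw [mem_closedBall_zero_iff, not_le] at hξ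
    exact hξ.le)

theorem IsCutoff.exists_norm_le (hχ : IsCutoff χ) : ∃ K : ℝ, 0 < K ∧ ∀ ξ, ‖χ ξ‖ ≤ K := by
  obtain ⟨K, hK⟩ := hχ.contDiff.continuous.bounded_above_of_compact_support hχ.hasCompactSupport
  exact ⟨max K 1, by positivity, fun ξ => (hK ξ).trans (le_max_left _ _)⟩

theorem IsCutoff.hasTemperateGrowth_dyadicSymbol (hχ : IsCutoff χ) (j : ℤ) :
    (fun ξ => dyadicSymbol χ j ((2 * Real.pi) • ξ)).HasTemperateGrowth := by
  have h (c : ℝ) (hc : c ≠ 0) : (fun ξ => χ (c • ξ)).HasTemperateGrowth :=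
    (hχ.hasCompactSupport.comp_smul hc).hasTemperateGrowth (hχ.contDiff.comp (by fun_prop))
  unfold dyadicSymbol
  simp only [smul_smul]
  exact (h _ (by positivity)).sub (h _ (by positivity))

theorem norm_inv_two_zpow_smul (j : ℤ) (ξ : EuclideanSpace ℝ (Fin n)) :
    ‖((2 : ℝ) ^ j)⁻¹ • ξ‖ = ‖ξ‖ / 2 ^ j := by
  rw [norm_smul, norm_inv, Real.norm_of_nonneg (by positivity), div_eq_inv_mul]

theorem IsCutoff.dyadicSymbol_eq_zero_of_le (hχ : IsCutoff χ) {j : ℤ}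
    {ξ : EuclideanSpace ℝ (Fin n)} (h : ‖ξ‖ ≤ 2 ^ (j - 1)) : dyadicSymbol χ j ξ = 0 := by
  have hle : (2 : ℝ) ^ (j - 1) ≤ 2 ^ j := zpow_le_zpow_right₀ one_le_two (by lia)
  rw [dyadicSymbol, hχ.eq_one, hχ.eq_one, sub_self] <;>
    rw [norm_inv_two_zpow_smul, div_le_one (by positivity)]
  exacts [h, h.trans hle]

theorem IsCutoff.dyadicSymbol_eq_zero_of_ge (hχ : IsCutoff χ) {j : ℤ}
    {ξ : EuclideanSpace ℝ (Fin n)} (h : 2 * 2 ^ j ≤ ‖ξ‖) : dyadicSymbol χ j ξ = 0 := by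
  have hle : (2 : ℝ) ^ (j - 1) ≤ 2 ^ j := zpow_le_zpow_right₀ one_le_two (by lia)
  rw [dyadicSymbol, hχ.eq_zero, hχ.eq_zero, sub_self] <;>
    rw [norm_inv_two_zpow_smul, le_div_iff₀ (by positivity)]
  exacts [(by gcongr : 2 * (2 : ℝ) ^ (j - 1) ≤ 2 * 2 ^ j).trans h, h]

theorem inv_one_add_mul_half_rpow_le {τ N β : ℝ} (hτ : 0 ≤ τ) (hN : 0 < N) (hβ : 0 < β) :
    (1 + τ * (N / 2) ^ β)⁻¹ ≤ 2 ^ β * (1 + τ * N ^ β)⁻¹ := by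
  have h2 : 1 ≤ (2 : ℝ) ^ β := Real.one_le_rpow one_le_two hβ.le
  have h : 0 ≤ τ * N ^ β := by positivity
  rw [Real.div_rpow hN.le zero_le_two, ← div_eq_mul_inv, inv_le_comm₀ (by positivity)
    (by positivity), inv_div, div_le_iff₀ (by positivity), add_mul, one_mul, mul_assoc,
    div_mul_cancel₀ _ (by positivity)]
  linarith

/-- The localised multiplier is supported in the ball `‖2πξ‖ ≤ 2N` and, where it does not vanish,
`‖2πξ‖ ≥ N / 2`, so that the decay of the Mittag-Leffler function applies. -/
theorem IsCutoff.norm_dyadicSymbol_mul_propagatorSymbol_le (hχ : IsCutoff χ) {α β t C K : ℝ}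
    (hβ : 0 < β) (ht : 0 ≤ t) (hC₀ : 0 ≤ C)
    (hC : ∀ s : ℝ, 0 ≤ s → ‖mittagLeffler α (-Complex.I * s)‖ ≤ C / (1 + s))
    (hK : ∀ ξ, ‖χ ξ‖ ≤ K) (j : ℤ) (ξ : EuclideanSpace ℝ (Fin n)) :
    ‖dyadicSymbol χ j ((2 * Real.pi) • ξ) * propagatorSymbol α β t ((2 * Real.pi) • ξ)‖ ≤
      (Metric.closedBall (0 : EuclideanSpace ℝ (Fin n)) (2 ^ j / Real.pi)).indicator
        (fun _ => 2 * K * (C * (2 ^ β * (1 + t ^ α * ((2 : ℝ) ^ j) ^ β)⁻¹))) ξ := by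
  have hpi := Real.pi_pos
  have hK₀ : 0 ≤ K := (norm_nonneg _).trans (hK 0)
  have hnonneg : 0 ≤ 2 * K * (C * (2 ^ β * (1 + t ^ α * ((2 : ℝ) ^ j) ^ β)⁻¹)) := by positivity
  have hnorm : ‖(2 * Real.pi) • ξ‖ = 2 * Real.pi * ‖ξ‖ := by
    rw [norm_smul, Real.norm_of_nonneg (by positivity)]
  have hhalf : (2 : ℝ) ^ (j - 1) = 2 ^ j / 2 := by rw [zpow_sub_one₀ two_ne_zero, div_eq_mul_inv]
  by_cases hξ : ξ ∈ Metric.closedBall (0 : EuclideanSpace ℝ (Fin n)) (2 ^ j / Real.pi)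
  · rw [indicator_of_mem hξ]
    rcases le_total ‖(2 * Real.pi) • ξ‖ (2 ^ (j - 1)) with h | h
    · rw [hχ.dyadicSymbol_eq_zero_of_le h, zero_mul, norm_zero]
      exact hnonneg
    · rw [norm_mul]
      refine mul_le_mul ?_ ((norm_propagatorSymbol_le ht hC _).trans ?_) (norm_nonneg _)
        (by positivity)
      · refine (norm_sub_le _ _).trans ?_
        linarith [hK (((2 : ℝ) ^ j)⁻¹ • (2 * Real.pi) • ξ),
          hK (((2 : ℝ) ^ (j - 1))⁻¹ • (2 * Real.pi) • ξ)]
      · rw [div_eq_mul_inv]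
        gcongr
        refine le_trans ?_ (inv_one_add_mul_half_rpow_le (Real.rpow_nonneg ht α) (by positivity) hβ)
        rw [← hhalf]
        gcongr
  · rw [indicator_of_notMem hξ, hχ.dyadicSymbol_eq_zero_of_ge, zero_mul, norm_zero]
    rw [mem_closedBall_zero_iff, not_le, div_lt_iff₀ hpi] at hξ
    rw [hnorm]
    linarith

end Dyadic

/-! ### Integrability and scaling of the symbol -/

section Integrability

theorem integrable_inv_one_add_norm_rpow {n : ℕ} {β : ℝ} (hβ : 0 < β) (hn : (n : ℝ) < β) :
    Integrable fun ξ : EuclideanSpace ℝ (Fin n) => (1 + ‖ξ‖ ^ β)⁻¹ := by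
  refine ((integrable_one_add_norm (E := EuclideanSpace ℝ (Fin n)) (μ := volume) (r := β)
    (by simpa using hn)).const_mul (2 ^ β)).mono'
    (Measurable.aestronglyMeasurable (by fun_prop)) (Filter.Eventually.of_forall fun ξ => ?_)
  have hr : 0 ≤ ‖ξ‖ := norm_nonneg ξ
  have key : (1 + ‖ξ‖) ^ β ≤ 2 ^ β * (1 + ‖ξ‖ ^ β) := by
    have hp : 0 ≤ ‖ξ‖ ^ β := by positivity
    have h2 : 0 ≤ (2 : ℝ) ^ β := by positivity
    rcases le_total ‖ξ‖ 1 with h | h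
    · have : (1 + ‖ξ‖) ^ β ≤ 2 ^ β := Real.rpow_le_rpow (by positivity) (by linarith) hβ.le
      nlinarith
    · have : (1 + ‖ξ‖) ^ β ≤ (2 * ‖ξ‖) ^ β :=
        Real.rpow_le_rpow (by positivity) (by linarith) hβ.le
      rw [Real.mul_rpow zero_le_two hr] at this
      nlinarith
  rw [Real.norm_of_nonneg (by positivity), Real.rpow_neg (by positivity), ← div_eq_mul_inv,
    inv_eq_one_div, div_le_div_iff₀ (by positivity) (by positivity), one_mul]
  exact key

/-- The factor `t ^ (-(n / β * α))` is the Jacobian of the substitution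
`ξ ↦ 2 π t ^ (α / β) ξ`, under which `t ^ α ‖2πξ‖ ^ β` becomes `‖ξ‖ ^ β`. -/
theorem integral_inv_one_add_mul_norm_rpow {n : ℕ} {α β t : ℝ} (hβ : 0 < β) (hn : (n : ℝ) < β)
    (ht : 0 < t) :
    Integrable (fun ξ : EuclideanSpace ℝ (Fin n) =>
      (1 + t ^ α * ‖(2 * Real.pi) • ξ‖ ^ β)⁻¹) ∧
    ∫ ξ : EuclideanSpace ℝ (Fin n), (1 + t ^ α * ‖(2 * Real.pi) • ξ‖ ^ β)⁻¹ =
      ((2 * Real.pi) ^ n)⁻¹ * t ^ (-(n / β * α)) *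
        ∫ ξ : EuclideanSpace ℝ (Fin n), (1 + ‖ξ‖ ^ β)⁻¹ := by
  have hpi := Real.pi_pos
  set R : ℝ := 2 * Real.pi * t ^ (α / β)
  have hR : 0 < R := by positivity
  have hfun : (fun ξ : EuclideanSpace ℝ (Fin n) => (1 + t ^ α * ‖(2 * Real.pi) • ξ‖ ^ β)⁻¹) =
      fun ξ => (1 + ‖R • ξ‖ ^ β)⁻¹ := by
    funext ξ
    rw [norm_smul, norm_smul, Real.norm_of_nonneg hR.le, Real.norm_of_nonneg (by positivity),
      show R * ‖ξ‖ = t ^ (α / β) * (2 * Real.pi * ‖ξ‖) by simp only [R]; ring,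
      Real.mul_rpow (x := t ^ (α / β)) (by positivity) (by positivity), ← Real.rpow_mul ht.le,
      div_mul_cancel₀ _ hβ.ne']
  rw [hfun]
  refine ⟨(integrable_inv_one_add_norm_rpow hβ hn).comp_smul hR.ne', ?_⟩
  rw [Measure.integral_comp_smul volume (fun ξ : EuclideanSpace ℝ (Fin n) => (1 + ‖ξ‖ ^ β)⁻¹),
    finrank_euclideanSpace_fin, smul_eq_mul, abs_of_pos (by positivity), mul_pow, mul_inv,
    Real.rpow_neg ht.le, ← Real.rpow_natCast (t ^ (α / β)), ← Real.rpow_mul ht.le]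
  congr 4
  ring

end Integrability

/-! ### The dispersive estimates -/

theorem mainTheorem1 (n : ℕ) (α β : ℝ) (hα₀ : 0 < α) (hα₁ : α < 1) (hβ : 0 < β) :
    (∀ χ : EuclideanSpace ℝ (Fin n) → ℂ, IsCutoff χ →
      ∃ C : ℝ, 0 < C ∧ ∀ t : ℝ, 0 ≤ t → ∀ j : ℤ,
        ∀ φ : Lp ℂ 1 (volume : Measure (EuclideanSpace ℝ (Fin n))),
          MemLp (propagatorHat α β t φ) ∞ (volume : Measure (EuclideanSpace ℝ (Fin n))) ∧
          ∃ g : Lp ℂ ∞ (volume : Measure (EuclideanSpace ℝ (Fin n))),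
            dyadicProjection χ j (propagator α β t φ) = Lp.toTemperedDistribution g ∧
            ‖g‖ ≤ C * (((2 : ℝ) ^ j) ^ n / (1 + t ^ α * ((2 : ℝ) ^ j) ^ β)) * ‖φ‖) ∧
    ((n : ℝ) < β →
      ∃ C : ℝ, 0 < C ∧ ∀ t : ℝ, 0 < t →
        ∀ φ : Lp ℂ 1 (volume : Measure (EuclideanSpace ℝ (Fin n))),
          MemLp (propagatorHat α β t φ) ∞ (volume : Measure (EuclideanSpace ℝ (Fin n))) ∧
          ∃ g : Lp ℂ ∞ (volume : Measure (EuclideanSpace ℝ (Fin n))),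
            propagator α β t φ = Lp.toTemperedDistribution g ∧
            ‖g‖ ≤ C * t ^ (-(n / β * α)) * ‖φ‖) := by
  have hpi := Real.pi_pos
  obtain ⟨C, hC₀, hC⟩ := exists_norm_mittagLeffler_le hα₀ hα₁
  have hmeas : ∀ t : ℝ, Measurable fun ξ : EuclideanSpace ℝ (Fin n) =>
      propagatorSymbol α β t ((2 * Real.pi) • ξ) := fun t =>
    (measurable_propagatorSymbol hα₀ β t).comp (measurable_const_smul (2 * Real.pi))
  refine ⟨fun χ hχ => ?_, fun hn => ?_⟩
  · obtain ⟨K, hK₀, hK⟩ := hχ.exists_norm_le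
    set V : ℝ := volume.real (Metric.ball (0 : EuclideanSpace ℝ (Fin n)) 1)
    have hV : 0 < V := by
      refine ENNReal.toReal_pos (Metric.measure_ball_pos _ _ one_pos).ne' measure_ball_lt_top.ne
    refine ⟨(Real.pi ^ n)⁻¹ * V * (2 * K * (C * 2 ^ β)), by positivity, fun t ht j φ => ?_⟩
    have hhat := memLp_propagatorHat (β := β) hα₀ hC₀.le ht hC φ
    refine ⟨hhat, ?_⟩
    have hψ := hχ.hasTemperateGrowth_dyadicSymbol j
    set m : EuclideanSpace ℝ (Fin n) → ℂ := fun ξ =>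
      dyadicSymbol χ j ((2 * Real.pi) • ξ) * propagatorSymbol α β t ((2 * Real.pi) • ξ)
    set D : ℝ := 2 * K * (C * (2 ^ β * (1 + t ^ α * ((2 : ℝ) ^ j) ^ β)⁻¹))
    have hD : 0 ≤ D := by positivity
    have hm := hχ.norm_dyadicSymbol_mul_propagatorSymbol_le hβ ht hC₀.le hC hK j
    have hball : volume (Metric.closedBall (0 : EuclideanSpace ℝ (Fin n)) (2 ^ j / Real.pi)) ≠ ⊤ :=
      measure_closedBall_lt_top.ne
    obtain ⟨hmem, g, hg, hgn⟩ := exists_multiplier_eq (m := m) (B := D)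
      (hψ.1.continuous.measurable.mul (hmeas t))
      (fun ξ => (hm ξ).trans (Set.indicator_le_self' (fun _ _ => hD) ξ))
      ((integrable_indicator_iff measurableSet_closedBall).2 (integrableOn_const hball)) hm φ
    have hassoc : (fun ξ => m ξ * 𝓕 (φ : EuclideanSpace ℝ (Fin n) → ℂ) ξ) =
        fun ξ => dyadicSymbol χ j ((2 * Real.pi) • ξ) * propagatorHat α β t φ ξ := by
      funext ξ
      exact mul_assoc _ _ _
    rw [hassoc] at hmem hg
    refine ⟨g, ?_, hgn.trans_eq ?_⟩
    · rw [dyadicProjection, propagator,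
        fourierMultiplierCLM_fourierInv_boundedToDistribution hψ hhat hmem, hg]
    · rw [integral_indicator measurableSet_closedBall, setIntegral_const,
        Measure.addHaar_real_closedBall _ _ (by positivity), finrank_euclideanSpace_fin]
      simp only [V, smul_eq_mul]
      ring
  · set J : ℝ := ∫ ξ : EuclideanSpace ℝ (Fin n), (1 + ‖ξ‖ ^ β)⁻¹
    have hJ : 0 ≤ J := integral_nonneg fun ξ => by positivity
    refine ⟨C * (((2 * Real.pi) ^ n)⁻¹ * (J + 1)), by positivity, fun t ht φ => ?_⟩
    obtain ⟨hint, hval⟩ := integral_inv_one_add_mul_norm_rpow (α := α) hβ hn ht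
    have hm : ∀ ξ : EuclideanSpace ℝ (Fin n), ‖propagatorSymbol α β t ((2 * Real.pi) • ξ)‖ ≤
        C * (1 + t ^ α * ‖(2 * Real.pi) • ξ‖ ^ β)⁻¹ := fun ξ =>
      (norm_propagatorSymbol_le ht.le hC _).trans_eq (div_eq_mul_inv _ _)
    obtain ⟨hmem, g, hg, hgn⟩ := exists_multiplier_eq (B := C) (hmeas t)
      (fun ξ => (hm ξ).trans (mul_le_of_le_one_right hC₀.le (inv_le_one_of_one_le₀ (by
        have : 0 ≤ t ^ α * ‖(2 * Real.pi) • ξ‖ ^ β := by positivity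
        linarith)))) (hint.const_mul C) hm φ
    refine ⟨hmem, g, hg, hgn.trans ?_⟩
    rw [integral_const_mul, hval]
    have hT : 0 < t ^ (-(n / β * α)) := Real.rpow_pos_of_pos ht _
    calc C * (((2 * Real.pi) ^ n)⁻¹ * t ^ (-(n / β * α)) * J) * ‖φ‖
        ≤ C * (((2 * Real.pi) ^ n)⁻¹ * t ^ (-(n / β * α)) * (J + 1)) * ‖φ‖ := by
          gcongr; linarith
      _ = _ := by ring
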